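/- For a real random variable $X$ and an integer $n\ge 1$ with $\mathsf{E}|X|^n<\infty$, let $m_k=\mathsf{E}[X^k]$ for $1\le k\le n$, and let the $n$-th cumulant of $X$ be \[ \kappa_n(X)=\sum_{\pi\in\mathcal P(n)}(-1)^{|\pi|-1}(|\pi|-1)!\prod_{B\in\pi}m_{|B|}, \] where $\mathcal P(n)$ is the set of all partitions of $\{1,\dots,n\}$ into nonempty blocks and $|\pi|$ is the number of blocks of $\pi$. Put \[ C_{\mathrm{sym}}(n)=\sum_{\substack{\pi\in\mathcal P(n)\\ |B|\text{ even for all }B\in\pi}}(|\pi|-1)!. \] Let $X$ be a real random variable that is symmetric about the origin, that is, $X$ and $-X$ have the same distribution. (i) If $n\ge 1$ is odd and $\mathsf{E}|X|^n<\infty$, then $\kappa_n(X)=0$. (ii) If $m\ge 1$ and $\mathsf{E}|X|^{2m}<\infty$, then $|\kappa_{2m}(X)|\le C_{\mathrm{sym}}(2m)\,\mathsf{E}|X|^{2m}$. Moreover, with $\rho_{\mathrm{sym}}=\operatorname{arcosh}2\approx 1.317$ (so $|\rho_{\mathrm{sym}}-1.317|<0.0005$), \[ C_{\mathrm{sym}}(2m)\sim\frac{2\,(2m-1)!}{\rho_{\mathrm{sym}}^{2m}}\qquad(m\to\infty).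 \] -/

import Mathlib

open MeasureTheory ProbabilityTheory Filter Asymptotics
open scoped Nat

/-- The `n`-th cumulant of a real random variable `X`, by the moment-cumulant formula: the sum over
all set partitions `π` of an `n`-element set of `(-1)^(|π|-1) (|π|-1)!` times the product over the
blocks `B` of the raw moments `E[X ^ |B|]`. It is meant for `n ≥ 1` (so that `|π| ≥ 1`) and for
`X` with a finite absolute moment of order `n`. -/
noncomputable def cumulant {Ω : Type*} [MeasurableSpace Ω] (X : Ω → ℝ) (n : ℕ) (μ : Measure Ω) : ℝ :=
  ∑ π : Finpartition (Finset.univ : Finset (Fin n)),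
    (-1 : ℝ) ^ (π.parts.card - 1) * ((π.parts.card - 1)! : ℝ) * ∏ B ∈ π.parts, moment X B.card μ

/-- The sum of `(|π|-1)!` over the set partitions `π` of an `n`-element set all of whose blocks
have even size. -/
def Csym (n : ℕ) : ℕ :=
  ∑ π : Finpartition (Finset.univ : Finset (Fin n)) with ∀ B ∈ π.parts, Even B.card,
    (π.parts.card - 1)!

/-- The rate `ρ_sym = arcosh 2`. -/
noncomputable def rhoSym : ℝ := Real.arcosh 2

/-! Symmetry kills the odd moments, so only partitions into even blocks contribute, and none exist
for odd `n`. Jensen bounds each moment by `|m_k| ≤ (E|X|^n)^(k/n)`; block sizes add up to `n`, so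
every product of moments is at most `E|X|^n`.

For the asymptotics, splitting off a block that misses a marked point gives a recursion for `Csym`.
After scaling by `ρ^(2m)/(2m-1)!` it is a renewal equation with waiting-time law `p k =
ρ^(2k)/(2k)!`, `k ≥ 1`, of mass `cosh ρ - 1 = 1`. The forcing terms sum to `ρ sinh ρ` and the mean
is `ρ sinh ρ / 2`, so the limit is their quotient, 2. The mean is below 2, which allows an
elementary proof of the renewal theorem. -/

/-! ### Partitions into even blocks -/

section EvenPartitions

variable {α : Type*} [DecidableEq α]

/-- The sum of `(|π|-1)!` over the partitions `π` of the finset `s` into blocks of even size. -/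
def evenPartitionWeight (s : Finset α) : ℕ :=
  ∑ π : Finpartition s with ∀ B ∈ π.parts, Even B.card, (π.parts.card - 1)!

theorem Finpartition.parts_avoid_of_mem {s B : Finset α} (π : Finpartition s) (hB : B ∈ π.parts) :
    (π.avoid B).parts = π.parts.erase B := by
  ext C
  rw [Finpartition.mem_avoid, Finset.mem_erase]
  constructor
  · rintro ⟨D, hD, hDB, rfl⟩
    have hne : D ≠ B := fun h => hDB h.le
    have hdisj : Disjoint D B := π.disjoint hD hB hne
    rw [Finset.sdiff_eq_self_of_disjoint hdisj]
    exact ⟨hne, hD⟩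
  · rintro ⟨hne, hC⟩
    have hdisj : Disjoint C B := π.disjoint hC hB hne
    exact ⟨C, hC, fun h => π.ne_bot hC (hdisj.eq_bot_of_le h),
      Finset.sdiff_eq_self_of_disjoint hdisj⟩

theorem Finpartition.filter_notMem_parts {s : Finset α} (π : Finpartition s) (a : α) :
    π.parts.filter (a ∉ ·) = π.parts.erase (π.part a) := by
  ext B
  rw [Finset.mem_filter, Finset.mem_erase, and_comm]
  refine and_congr_left fun hB => ?_
  rw [← π.part_eq_iff_mem hB, ne_comm]

/-- Exactly `|π| - 1` blocks miss `a`; the indicator covers the one-block case, where that sum is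
empty. -/
theorem Finpartition.factorial_card_parts_sub_one {s : Finset α} (π : Finpartition s) {a : α}
    (ha : a ∈ s) :
    (π.parts.card - 1)! = (if π.parts.card = 1 then 1 else 0) +
      ∑ _B ∈ π.parts with a ∉ _B, (π.parts.card - 2)! := by
  rw [Finset.sum_const, π.filter_notMem_parts, Finset.card_erase_of_mem (π.part_mem.2 ha)]
  have hpos : 0 < π.parts.card := Finset.card_pos.2 ⟨_, π.part_mem.2 ha⟩
  obtain ⟨k, hk⟩ : ∃ k, π.parts.card = k + 1 := ⟨_, (Nat.succ_pred_eq_of_pos hpos).symm⟩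
  rw [hk]
  cases k with
  | zero => simp
  | succ k => simp [Nat.factorial_succ]

theorem Finpartition.card_parts_eq_one_iff {s : Finset α} (hs : s ≠ ⊥) (π : Finpartition s) :
    π.parts.card = 1 ↔ π = Finpartition.indiscrete hs := by
  constructor
  · intro h
    obtain ⟨B, hB⟩ := Finset.card_eq_one.1 h
    have := π.sup_parts
    rw [hB, Finset.sup_singleton, id] at this
    apply Finpartition.ext
    rw [hB, this]
    rfl
  · rintro rfl
    rfl

/-- Splitting off a block that avoids a marked element. -/
theorem evenPartitionWeight_eq {s : Finset α} {a : α} (ha : a ∈ s) (hs : Even s.card) :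
    evenPartitionWeight s = 1 +
      ∑ B ∈ (s.erase a).powerset with B ≠ ∅ ∧ Even B.card, evenPartitionWeight (s \ B) := by
  have hs0 : s ≠ ⊥ := Finset.ne_empty_of_mem ha
  unfold evenPartitionWeight
  rw [Finset.sum_congr rfl fun π _ => π.factorial_card_parts_sub_one ha, Finset.sum_add_distrib]
  congr 1
  · rw [Finset.sum_eq_single_of_mem (Finpartition.indiscrete hs0)]
    · simp
    · simpa using hs
    · intro π _ hπ
      rw [if_neg (mt (π.card_parts_eq_one_iff hs0).1 hπ)]
  · rw [Finset.sum_sigma', Finset.sum_sigma']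
    -- Removing the chosen block and adjoining it again are mutually inverse.
    refine Finset.sum_bij' (fun x _ => ⟨x.2, x.1.avoid x.2⟩)
      (fun y hy => ⟨y.2.extend (b := y.1) (c := s)
        (Finset.mem_filter.1 (Finset.mem_sigma.1 hy).1).2.1 Finset.sdiff_disjoint
        (Finset.sdiff_union_of_subset ((Finset.mem_powerset.1
          (Finset.mem_filter.1 (Finset.mem_sigma.1 hy).1).1).trans (Finset.erase_subset _ _))),
        y.1⟩) ?_ ?_ ?_ ?_ ?_
    · rintro ⟨π, B⟩ h
      simp only [Finset.mem_sigma, Finset.mem_filter, Finset.mem_univ, true_and,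
        Finset.mem_powerset] at h ⊢
      obtain ⟨hev, hB, haB⟩ := h
      refine ⟨⟨Finset.subset_erase.2 ⟨π.le hB, haB⟩, π.ne_empty hB, hev B hB⟩, ?_⟩
      rw [π.parts_avoid_of_mem hB]
      exact fun C hC => hev C (Finset.mem_of_mem_erase hC)
    · rintro ⟨B, π⟩ h
      simp only [Finset.mem_sigma, Finset.mem_filter, Finset.mem_univ, true_and,
        Finset.mem_powerset] at h ⊢
      obtain ⟨⟨hB, hB0, hBe⟩, hev⟩ := h
      refine ⟨?_, Finset.mem_insert_self _ _, (Finset.subset_erase.1 hB).2⟩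
      intro C hC
      rcases Finset.mem_insert.1 hC with rfl | hC
      exacts [hBe, hev C hC]
    · rintro ⟨π, B⟩ h
      simp only [Finset.mem_sigma, Finset.mem_filter, Finset.mem_univ, true_and] at h
      refine Sigma.ext (Finpartition.ext ?_) HEq.rfl
      simp only [Finpartition.extend_parts]
      rw [π.parts_avoid_of_mem h.2.1, Finset.insert_erase h.2.1]
    · rintro ⟨B, π⟩ h
      simp only [Finset.mem_sigma, Finset.mem_filter, Finset.mem_univ, true_and] at h
      refine Sigma.ext rfl (heq_of_eq (Finpartition.ext ?_))
      rw [Finpartition.parts_avoid_of_mem _ (Finset.mem_insert_self _ _)]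
      refine Finset.erase_insert fun hB => h.1.2.1 ?_
      exact Finset.sdiff_disjoint.symm.eq_bot_of_le (π.le hB)
    · rintro ⟨π, B⟩ h
      simp only [Finset.mem_sigma, Finset.mem_filter, Finset.mem_univ, true_and] at h
      simp only
      rw [π.parts_avoid_of_mem h.2.1, Finset.card_erase_of_mem h.2.1]
      rfl

end EvenPartitions

theorem Csym_eq_evenPartitionWeight (n : ℕ) :
    Csym n = evenPartitionWeight (Finset.univ : Finset (Fin n)) := by
  unfold Csym evenPartitionWeight
  congr!

/-- The recursion involves only cardinalities, so strong induction replaces transport of partitions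
along a bijection. -/
theorem evenPartitionWeight_eq_Csym {α : Type} [DecidableEq α] (s : Finset α) (hs : s.Nonempty)
    (he : Even s.card) : evenPartitionWeight s = Csym s.card := by
  obtain ⟨n, hn⟩ : ∃ n, n = s.card := ⟨_, rfl⟩
  induction n using Nat.strong_induction_on generalizing α with
  | _ n ih =>
    subst hn
    obtain ⟨a, ha⟩ := hs
    have key : ∀ {β : Type} [DecidableEq β] (t : Finset β) (b : β), b ∈ t → t.card = s.card →
        evenPartitionWeight t = 1 + ∑ j ∈ Finset.range s.card,
          (s.card - 1).choose j • if j ≠ 0 ∧ Even j then Csym (s.card - j) else 0 := by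
      intro β _ t b hb hts
      rw [evenPartitionWeight_eq hb (hts ▸ he), Finset.sum_filter]
      have hc : (t.erase b).card = s.card - 1 := by rw [Finset.card_erase_of_mem hb, hts]
      have hc' : s.card - 1 + 1 = s.card :=
        Nat.sub_add_cancel (Finset.card_pos.2 ⟨a, ha⟩)
      have := Finset.sum_powerset_apply_card
        (fun j => if j ≠ 0 ∧ Even j then Csym (s.card - j) else 0) (x := t.erase b)
      rw [hc, hc'] at this
      rw [← this]
      congr 1
      refine Finset.sum_congr rfl fun B hB => ?_
      rw [Finset.mem_powerset, Finset.subset_erase] at hB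
      simp only [← Finset.nonempty_iff_ne_empty, ← Finset.card_ne_zero]
      split_ifs with h
      · have hcard : (t \ B).card = s.card - B.card := by
          rw [Finset.card_sdiff_of_subset hB.1, hts]
        have hpos : 0 < s.card := Finset.card_pos.2 ⟨a, ha⟩
        have hle : B.card ≤ s.card := hts ▸ Finset.card_le_card hB.1
        rw [← hcard]
        refine ih _ ?_ (t \ B) ⟨b, Finset.mem_sdiff.2 ⟨hb, hB.2⟩⟩ ?_ rfl
        · omega
        · rw [hcard]; exact (Nat.even_sub hle).2 (iff_of_true he h.2)
      · rfl
    rw [key s a ha rfl, Csym_eq_evenPartitionWeight,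
      key Finset.univ ⟨0, Finset.card_pos.2 ⟨a, ha⟩⟩ (Finset.mem_univ _) (by simp)]

theorem sum_range_two_mul_ite_even {M : Type*} [AddCommMonoid M] (f : ℕ → M) (m : ℕ) :
    ∑ j ∈ Finset.range (2 * m), (if Even j then f j else 0) =
      ∑ k ∈ Finset.range m, f (2 * k) := by
  induction m with
  | zero => simp
  | succ m ih =>
    rw [Nat.mul_succ, Finset.sum_range_succ, Finset.sum_range_succ, ih, Finset.sum_range_succ]
    simp

theorem Csym_two_mul_succ (m : ℕ) :
    Csym (2 * (m + 1)) = 1 + ∑ k ∈ Finset.range m,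
      (2 * m + 1).choose (2 * (k + 1)) * Csym (2 * (m - k)) := by
  rw [Csym_eq_evenPartitionWeight, evenPartitionWeight_eq (a := ⟨0, by omega⟩)
    (Finset.mem_univ _) (by simp), Finset.sum_filter]
  have := Finset.sum_powerset_apply_card
    (fun j => if Even j then (if j ≠ 0 then Csym (2 * (m + 1) - j) else 0) else 0)
    (x := (Finset.univ : Finset (Fin (2 * (m + 1)))).erase ⟨0, by omega⟩)
  rw [Finset.card_erase_of_mem (Finset.mem_univ _), Finset.card_univ, Fintype.card_fin,
    Nat.sub_add_cancel (by omega)] at this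
  simp only [smul_ite, smul_zero] at this
  rw [sum_range_two_mul_ite_even, Finset.sum_range_succ'] at this
  simp only [mul_zero, ne_eq, not_true_eq_false, if_false, add_zero, Nat.mul_eq_zero,
    Nat.add_eq_zero_iff, one_ne_zero, and_false, or_false, OfNat.ofNat_ne_zero, not_false_eq_true,
    if_true, smul_eq_mul] at this
  rw [show 2 * (m + 1) - 1 = 2 * m + 1 by omega] at this
  have hsub : ∀ k, 2 * (m + 1) - 2 * (k + 1) = 2 * (m - k) := fun k => by omega
  simp only [hsub] at this
  rw [← this]
  congr 1
  refine Finset.sum_congr rfl fun B hB => ?_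
  rw [Finset.mem_powerset, Finset.subset_erase] at hB
  by_cases hB0 : B = ∅
  · simp [hB0]
  by_cases hBe : Even B.card
  · have hcard : (Finset.univ \ B).card = 2 * (m + 1) - B.card := by
      rw [Finset.card_sdiff_of_subset hB.1]; simp
    rw [if_pos ⟨hB0, hBe⟩, if_pos hBe, if_pos (by simpa using hB0), ← hcard]
    refine evenPartitionWeight_eq_Csym _ ⟨_, Finset.mem_sdiff.2 ⟨Finset.mem_univ _, hB.2⟩⟩ ?_
    have hle : B.card ≤ 2 * (m + 1) := by simpa using Finset.card_le_univ B
    rw [hcard]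
    exact (Nat.even_sub hle).2 (iff_of_true (by simp) hBe)
  · rw [if_neg (fun h => hBe h.2), if_neg hBe]

/-! ### A renewal theorem -/

section Renewal

/-- The coefficient `r 0 = 1` dominates the remaining mass `θ < 1`, so partial sums satisfy `(1 - θ)
∑ |d| ≤ ∑ |g|`. -/
theorem summable_abs_of_convolution_eq {r d g : ℕ → ℝ} (hr : ∀ k, 0 ≤ r k) (hr0 : r 0 = 1)
    (hrs : Summable r) (hr2 : ∑' k, r k < 2) (hg : Summable fun n => |g n|)
    (h : ∀ m, ∑ k ∈ Finset.range (m + 1), r k * d (m - k) = g m) :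
    Summable fun n => |d n| := by
  set θ : ℝ := ∑' k, r (k + 1) with hθ
  have hrs1 : Summable fun k => r (k + 1) := (summable_nat_add_iff 1).2 hrs
  have hθ1 : θ < 1 := by
    have := hrs.tsum_eq_zero_add
    rw [hr0] at this
    linarith
  -- The factor 2 comes from adding `|d m|` to both sides, which completes the convolution.
  have hpt : ∀ m, 2 * |d m| ≤ |g m| + ∑ k ∈ Finset.range (m + 1), r k * |d (m - k)| := by
    intro m
    have h1 := h m
    rw [Finset.sum_range_succ', hr0, one_mul, Nat.sub_zero] at h1
    rw [Finset.sum_range_succ', hr0, one_mul, Nat.sub_zero]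
    have h2 : |∑ k ∈ Finset.range m, r (k + 1) * d (m - (k + 1))| ≤
        ∑ k ∈ Finset.range m, r (k + 1) * |d (m - (k + 1))| :=
      (Finset.abs_sum_le_sum_abs _ _).trans_eq <| Finset.sum_congr rfl fun k _ => by
        rw [abs_mul, abs_of_nonneg (hr _)]
    have h3 : |d m| ≤ |g m| + |∑ k ∈ Finset.range m, r (k + 1) * d (m - (k + 1))| := by
      rw [← h1]
      have := abs_sub (∑ k ∈ Finset.range m, r (k + 1) * d (m - (k + 1)) + d m)
        (∑ k ∈ Finset.range m, r (k + 1) * d (m - (k + 1)))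
      rwa [add_sub_cancel_left] at this
    linarith
  refine summable_of_sum_range_le (c := (∑' n, |g n|) / (1 - θ)) (fun n => abs_nonneg _) fun N => ?_
  rw [le_div_iff₀ (by linarith)]
  have hflip := Finset.sum_range_diag_flip N (fun k j => r k * |d j|)
  have hle : ∑ k ∈ Finset.range N, ∑ j ∈ Finset.range (N - k), r k * |d j| ≤
      (1 + θ) * ∑ j ∈ Finset.range N, |d j| := by
    calc _ ≤ ∑ k ∈ Finset.range N, r k * ∑ j ∈ Finset.range N, |d j| := by
          refine Finset.sum_le_sum fun k _ => ?_
          rw [← Finset.mul_sum]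
          exact mul_le_mul_of_nonneg_left (Finset.sum_le_sum_of_subset_of_nonneg
            (Finset.range_subset_range.2 (Nat.sub_le _ _)) fun _ _ _ => abs_nonneg _) (hr k)
      _ = (∑ k ∈ Finset.range N, r k) * ∑ j ∈ Finset.range N, |d j| := by rw [Finset.sum_mul]
      _ ≤ _ := by
          refine mul_le_mul_of_nonneg_right ?_ (Finset.sum_nonneg fun _ _ => abs_nonneg _)
          have := hrs.tsum_eq_zero_add
          rw [hr0, ← hθ] at this
          rw [← this]
          exact hrs.sum_le_tsum _ fun _ _ => hr _
  have hsum := Finset.sum_le_sum fun m (_ : m ∈ Finset.range N) => hpt m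
  rw [Finset.sum_add_distrib, ← Finset.mul_sum] at hsum
  have hgle : ∑ m ∈ Finset.range N, |g m| ≤ ∑' n, |g n| :=
    hg.sum_le_tsum _ fun _ _ => abs_nonneg _
  nlinarith

/-- A renewal theorem: if `u` solves `u (m + 1) = g m + ∑ p_{k+1} u (m - k)` with `u 0 = 0` and `r`
is the tail sequence of the waiting-time law `p`, of total mass `< 2`, then `u` converges. -/
theorem tendsto_of_renewal {p r g u : ℕ → ℝ} (hr : ∀ k, 0 ≤ r k) (hr0 : r 0 = 1)
    (hrp : ∀ k, r k - r (k + 1) = p (k + 1)) (hrs : Summable r) (hr2 : ∑' k, r k < 2)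
    (hg : Summable fun n => |g n|) (hu0 : u 0 = 0)
    (hu : ∀ m, u (m + 1) = g m + ∑ k ∈ Finset.range (m + 1), p (k + 1) * u (m - k)) :
    Tendsto u atTop (nhds ((∑' n, g n) / ∑' k, r k)) := by
  -- Summation by parts: tails convolved with increments of `u` give `g`. The Cauchy product then
  -- yields `(∑ r) * lim u = ∑ g`.
  have hconv : ∀ m, ∑ k ∈ Finset.range (m + 1), r k * (u (m - k + 1) - u (m - k)) = g m := by
    intro m
    have h1 : ∑ k ∈ Finset.range (m + 1), r k * u (m - k + 1) =
        ∑ k ∈ Finset.range (m + 2), r k * u (m + 1 - k) := by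
      rw [Finset.sum_range_succ _ (m + 1), Nat.sub_self, hu0, mul_zero, add_zero]
      refine Finset.sum_congr rfl fun k hk => ?_
      rw [Finset.mem_range] at hk
      rw [show m - k + 1 = m + 1 - k by omega]
    simp only [mul_sub, Finset.sum_sub_distrib]
    rw [h1, Finset.sum_range_succ', hr0, one_mul, Nat.sub_zero, hu m]
    simp only [Nat.add_sub_add_right, ← hrp, sub_mul, Finset.sum_sub_distrib]
    ring
  have hd := summable_abs_of_convolution_eq (d := fun j => u (j + 1) - u j) hr hr0 hrs hr2 hg hconv
  have hprod := tsum_mul_tsum_eq_tsum_sum_range_of_summable_norm (f := r)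
    (g := fun j => u (j + 1) - u j) (by simpa only [Real.norm_eq_abs] using hrs.abs)
    (by simpa only [Real.norm_eq_abs] using hd)
  simp only [hconv] at hprod
  have hpos : 0 < ∑' k, r k := hrs.tsum_pos hr 0 (by rw [hr0]; exact one_pos)
  have hlim := hd.of_abs.hasSum.tendsto_sum_nat
  simp only [Finset.sum_range_sub, hu0, sub_zero] at hlim
  rwa [← hprod, mul_div_cancel_left₀ _ hpos.ne']

/-- By Tonelli: `p n` occurs in the tails from `k = 0, …, n`, hence `n + 1` times. -/
theorem hasSum_tail_sums {p : ℕ → ℝ} {a : ℝ} (hp : ∀ k, 0 ≤ p k)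
    (h : HasSum (fun n : ℕ => (n + 1) * p n) a) :
    HasSum (fun k => ∑' i, p (k + i)) a := by
  have hfib : ∀ n : ℕ, HasSum (fun _ : Finset.HasAntidiagonal.antidiagonal n => p n)
      ((n + 1) * p n) := fun n => by
    simpa using hasSum_fintype (fun _ : Finset.HasAntidiagonal.antidiagonal n => p n)
  have hsig : Summable fun x : Σ n : ℕ, Finset.HasAntidiagonal.antidiagonal n => p x.1 := by
    refine (summable_sigma_of_nonneg fun x => hp _).2 ⟨fun n => (hfib n).summable, ?_⟩
    simpa only [(hfib _).tsum_eq] using h.summable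
  have hsum : HasSum (fun x : Σ n : ℕ, Finset.HasAntidiagonal.antidiagonal n => p x.1) a := by
    rw [h.unique (hsig.hasSum.sigma hfib)]
    exact hsig.hasSum
  have hprod : HasSum (fun x : ℕ × ℕ => p (x.1 + x.2)) a :=
    (Finset.HasAntidiagonal.sigmaAntidiagonalEquivProd (A := ℕ)).symm.hasSum_iff.2 hsum
  exact hprod.prod_fiberwise fun k => (hprod.summable.prod_factor k).hasSum

end Renewal

/-! ### Values and numerical bounds for `rhoSym` -/

theorem rhoSym_pos : 0 < rhoSym := Real.arcosh_pos (by norm_num)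

theorem cosh_rhoSym : Real.cosh rhoSym = 2 := Real.cosh_arcosh (by norm_num)

theorem sinh_rhoSym : Real.sinh rhoSym = √3 := by
  rw [rhoSym, Real.sinh_arcosh (by norm_num)]; norm_num

theorem rhoSym_lt : rhoSym < 1.3175 := by
  rw [rhoSym, ← Real.exp_lt_exp, Real.exp_arcosh (by norm_num)]
  have h3 : √(2 ^ 2 - 1 : ℝ) < 1.7321 := by
    rw [Real.sqrt_lt' (by norm_num)]; norm_num
  have := Real.sum_le_exp_of_nonneg (x := 1.3175) (by norm_num) 10
  simp only [Finset.sum_range_succ, Finset.sum_range_zero, Nat.factorial] at this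
  norm_num at this h3 ⊢
  linarith

theorem lt_rhoSym : 1.3165 < rhoSym := by
  rw [rhoSym, ← Real.exp_lt_exp, Real.exp_arcosh (by norm_num)]
  have h3 : 1.732 < √(2 ^ 2 - 1 : ℝ) := by
    rw [Real.lt_sqrt (by norm_num)]; norm_num
  -- This upper bound needs `x ≤ 1`, so it is applied to half of 1.3165 and squared.
  have h := Real.exp_bound' (x := 0.65825) (by norm_num) (by norm_num) (n := 8) (by norm_num)
  have h' : Real.exp 0.65825 ≤ 1.9315 := by
    refine h.trans ?_
    simp only [Finset.sum_range_succ, Finset.sum_range_zero, Nat.factorial]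
    norm_num
  have hsq : Real.exp 1.3165 = Real.exp 0.65825 ^ 2 := by
    rw [← Real.exp_nat_mul]; norm_num
  rw [hsq]
  have : Real.exp 0.65825 ^ 2 ≤ 1.9315 ^ 2 := pow_le_pow_left₀ (Real.exp_pos _).le h' 2
  norm_num at this h3 ⊢
  linarith

/-! ### Asymptotics of the constants -/

theorem Csym_renewal (ρ : ℝ) (m : ℕ) :
    (Csym (2 * (m + 1)) : ℝ) * ρ ^ (2 * (m + 1)) / ((2 * m + 1)! : ℝ) =
      ρ ^ (2 * (m + 1)) / ((2 * m + 1)! : ℝ) + ∑ k ∈ Finset.range m,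
        ρ ^ (2 * (k + 1)) / ((2 * (k + 1))! : ℝ) *
          (Csym (2 * (m - k)) * ρ ^ (2 * (m - k)) / ((2 * (m - k) - 1)! : ℝ)) := by
  rw [Csym_two_mul_succ, Nat.cast_add, Nat.cast_one, add_mul, one_mul, add_div, Nat.cast_sum,
    Finset.sum_mul, Finset.sum_div]
  congr 1
  refine Finset.sum_congr rfl fun k hk => ?_
  rw [Finset.mem_range] at hk
  have hle : 2 * (k + 1) ≤ 2 * m + 1 := by omega
  have hpow : ρ ^ (2 * (m + 1)) = ρ ^ (2 * (k + 1)) * ρ ^ (2 * (m - k)) := by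
    rw [← pow_add]; congr 1; omega
  rw [Nat.cast_mul, Nat.cast_choose ℝ hle, hpow,
    show 2 * m + 1 - 2 * (k + 1) = 2 * (m - k) - 1 by omega]
  have h1 : ((2 * m + 1)! : ℝ) ≠ 0 := Nat.cast_ne_zero.2 (Nat.factorial_ne_zero _)
  field_simp

theorem tendsto_Csym_mul_rhoSym_pow :
    Tendsto (fun m : ℕ => (Csym (2 * m) : ℝ) * rhoSym ^ (2 * m) / ((2 * m - 1)! : ℝ)) atTop
      (nhds 2) := by
  have hρ := rhoSym_pos
  set p : ℕ → ℝ := fun k => rhoSym ^ (2 * k) / ((2 * k)! : ℝ) with hp_def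
  have hp : ∀ k, 0 ≤ p k := fun k => by positivity
  have hp0 : p 0 = 1 := by simp [p]
  have hpsum : HasSum p 2 := cosh_rhoSym ▸ Real.hasSum_cosh rhoSym
  set r : ℕ → ℝ := fun k => ∑' i, p (k + i + 1) with hr_def
  have hsinh := Real.hasSum_sinh rhoSym
  -- The tails sum to the mean `∑ k * p k`, a multiple of the `sinh` series.
  have hr_sum : HasSum r (rhoSym * Real.sinh rhoSym / 2) := by
    refine hasSum_tail_sums (p := fun n => p (n + 1)) (fun k => hp _) ?_
    rw [mul_div_right_comm]
    convert! hsinh.mul_left (rhoSym / 2) using 2 with n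
    have h1 : ((2 * n + 1)! : ℝ) ≠ 0 := Nat.cast_ne_zero.2 (Nat.factorial_ne_zero _)
    have h2 : (n : ℝ) + 1 ≠ 0 := by positivity
    simp only [hp_def, show 2 * (n + 1) = 2 * n + 1 + 1 by ring, Nat.factorial_succ (2 * n + 1)]
    push_cast
    rw [show (2 * (n : ℝ) + 1 + 1) = 2 * (n + 1) by ring]
    field_simp
    ring
  have hr0 : r 0 = 1 := by
    have := hpsum.summable.tsum_eq_zero_add
    rw [hpsum.tsum_eq, hp0] at this
    simp only [hr_def, zero_add]
    linarith
  have hrp : ∀ k, r k - r (k + 1) = p (k + 1) := fun k => by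
    have hs : Summable fun i => p (k + i + 1) := by
      have := (summable_nat_add_iff (k + 1)).2 hpsum.summable
      simpa only [← add_assoc, add_comm _ k] using this
    have := hs.tsum_eq_zero_add
    simp only [hr_def, this, add_zero]
    simp only [add_comm, add_left_comm, add_sub_cancel_right]
  set g : ℕ → ℝ := fun m => rhoSym ^ (2 * (m + 1)) / ((2 * m + 1)! : ℝ) with hg_def
  have hg : HasSum g (rhoSym * Real.sinh rhoSym) := by
    convert! hsinh.mul_left rhoSym using 2 with n
    simp only [hg_def]
    ring
  have hpos : 0 < rhoSym * Real.sinh rhoSym := mul_pos hρ (Real.sinh_pos_iff.2 hρ)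
  have hlt : rhoSym * Real.sinh rhoSym / 2 < 2 := by
    rw [sinh_rhoSym]
    have h3 : √(3 : ℝ) < 2 := by rw [Real.sqrt_lt' (by norm_num)]; norm_num
    have := rhoSym_lt
    nlinarith [Real.sqrt_nonneg 3]
  -- The value at 0 is reset: the formula gives 1 there, while the renewal equation needs `u 0 = 0`,
  -- so that its `k = m` term vanishes.
  set u : ℕ → ℝ := fun m =>
    if m = 0 then 0 else (Csym (2 * m) : ℝ) * rhoSym ^ (2 * m) / ((2 * m - 1)! : ℝ) with hu_def
  have hlim := tendsto_of_renewal (p := p) (r := r) (g := g) (u := u)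
    (fun k => tsum_nonneg fun i => hp _) hr0 hrp hr_sum.summable (hr_sum.tsum_eq ▸ hlt)
    hg.summable.abs rfl fun m => by
      rw [Finset.sum_range_succ, Nat.sub_self]
      simp only [hu_def, if_true, mul_zero, add_zero, Nat.add_eq_zero_iff, one_ne_zero, and_false,
        if_false]
      rw [show 2 * (m + 1) - 1 = 2 * m + 1 by omega, Csym_renewal]
      congr 1
      refine Finset.sum_congr rfl fun k hk => ?_
      rw [Finset.mem_range] at hk
      rw [if_neg (by omega)]
  rw [hg.tsum_eq, hr_sum.tsum_eq, div_div_cancel₀ hpos.ne'] at hlim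
  refine hlim.congr' ?_
  filter_upwards [eventually_ne_atTop 0] with m hm
  exact if_neg hm

theorem Csym_isEquivalent :
    (fun m : ℕ => (Csym (2 * m) : ℝ)) ~[atTop]
      (fun m : ℕ => 2 * ((2 * m - 1)! : ℝ) / rhoSym ^ (2 * m)) := by
  have hne : ∀ m : ℕ, 2 * ((2 * m - 1)! : ℝ) / rhoSym ^ (2 * m) ≠ 0 := fun m => by
    have := rhoSym_pos
    positivity
  rw [isEquivalent_iff_tendsto_one (Eventually.of_forall hne)]
  have h := tendsto_Csym_mul_rhoSym_pow.div_const 2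
  rw [div_self two_ne_zero] at h
  refine h.congr fun m => ?_
  have := rhoSym_pos
  simp only [Pi.div_apply]
  field_simp

/-! ### Cumulants of symmetric random variables -/

section Cumulant

variable {Ω : Type*} [MeasurableSpace Ω] {μ : Measure Ω} {X : Ω → ℝ}

theorem moment_eq_zero_of_odd (hX : IdentDistrib X (fun ω => -X ω) μ μ) {k : ℕ} (hk : Odd k) :
    moment X k μ = 0 := by
  have h := (hX.comp (u := fun x : ℝ => x ^ k) (by fun_prop)).integral_eq
  simp only [Function.comp_def, hk.neg_pow, integral_neg] at h
  have : moment X k μ = ∫ ω, X ω ^ k ∂μ := rfl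
  linarith

/-- Jensen for the concave map `t ↦ t^(k/n)` applied to `|X|^n`. -/
theorem abs_moment_le_rpow [IsProbabilityMeasure μ] (hX : AEMeasurable X μ) {k n : ℕ} (hn : n ≠ 0)
    (hkn : k ≤ n) (hint : Integrable (fun ω => |X ω| ^ n) μ) :
    |moment X k μ| ≤ (∫ ω, |X ω| ^ n ∂μ) ^ ((k : ℝ) / n) := by
  have hn' : (n : ℝ) ≠ 0 := Nat.cast_ne_zero.2 hn
  have hrpow : ∀ ω, (|X ω| ^ n) ^ ((k : ℝ) / n) = |X ω| ^ k := fun ω => by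
    rw [← Real.rpow_natCast, ← Real.rpow_mul (abs_nonneg _), mul_div_cancel₀ _ hn',
      Real.rpow_natCast]
  have hintk : Integrable (fun ω => |X ω| ^ k) μ := by
    refine ((integrable_const (1 : ℝ)).add hint).mono' (by fun_prop) (ae_of_all _ fun ω => ?_)
    rw [Real.norm_of_nonneg (by positivity), Pi.add_apply]
    rcases le_total |X ω| 1 with h | h
    · have := pow_le_one₀ (n := k) (abs_nonneg (X ω)) h
      have := pow_nonneg (abs_nonneg (X ω)) n
      linarith
    · have := pow_le_pow_right₀ h hkn
      linarith
  have hjensen := (Real.concaveOn_rpow (p := (k : ℝ) / n) (by positivity)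
    (div_le_one_of_le₀ (Nat.cast_le.2 hkn) (Nat.cast_nonneg _))).le_map_integral (μ := μ)
    (f := fun ω => |X ω| ^ n)
    (continuousOn_id.rpow_const fun _ _ => Or.inr (by positivity)) isClosed_Ici
    (ae_of_all _ fun ω => Set.mem_Ici.2 (by positivity)) hint
    (by simpa only [Function.comp_def, hrpow] using hintk)
  simp only [hrpow] at hjensen
  refine le_trans ?_ hjensen
  have h := abs_integral_le_integral_abs (μ := μ) (f := fun ω => X ω ^ k)
  simp only [abs_pow] at h
  exact h

theorem cumulant_eq_zero_of_odd (hX : IdentDistrib X (fun ω => -X ω) μ μ) {n : ℕ} (hn : Odd n) :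
    cumulant X n μ = 0 := by
  refine Finset.sum_eq_zero fun π _ => ?_
  obtain ⟨B, hB, hodd⟩ : ∃ B ∈ π.parts, Odd B.card := by
    by_contra! h
    have := π.sum_card_parts
    rw [Finset.card_univ, Fintype.card_fin] at this
    rw [← this, ← Nat.not_even_iff_odd] at hn
    exact hn (Finset.even_sum _ fun B hB => Nat.not_odd_iff_even.1 (h B hB))
  rw [Finset.prod_eq_zero hB (moment_eq_zero_of_odd hX hodd), mul_zero]

theorem abs_cumulant_le_of_symmetric [IsProbabilityMeasure μ] (hXm : AEMeasurable X μ)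
    (hX : IdentDistrib X (fun ω => -X ω) μ μ) {n : ℕ} (hn : n ≠ 0)
    (hint : Integrable (fun ω => |X ω| ^ n) μ) :
    |cumulant X n μ| ≤ (Csym n : ℝ) * ∫ ω, |X ω| ^ n ∂μ := by
  set A : ℝ := ∫ ω, |X ω| ^ n ∂μ
  have hA : 0 ≤ A := integral_nonneg fun ω => by positivity
  have hn' : (n : ℝ) ≠ 0 := Nat.cast_ne_zero.2 hn
  rw [Csym, Nat.cast_sum, Finset.sum_mul, Finset.sum_filter]
  refine (Finset.abs_sum_le_sum_abs _ _).trans (Finset.sum_le_sum fun π _ => ?_)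
  split_ifs with h
  · rw [abs_mul, abs_mul, abs_pow, abs_neg, abs_one, one_pow, one_mul, Nat.abs_cast,
      Finset.abs_prod]
    refine mul_le_mul_of_nonneg_left ?_ (Nat.cast_nonneg _)
    calc ∏ B ∈ π.parts, |moment X B.card μ| ≤ ∏ B ∈ π.parts, A ^ ((B.card : ℝ) / n) := by
          refine Finset.prod_le_prod (fun _ _ => abs_nonneg _) fun B _ =>
            abs_moment_le_rpow hXm hn ?_ hint
          simpa using Finset.card_le_univ B
      _ = A := by
          rw [← Real.rpow_sum_of_nonneg hA fun _ _ => by positivity, ← Finset.sum_div,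
            ← Nat.cast_sum, π.sum_card_parts, Finset.card_univ, Fintype.card_fin, div_self hn',
            Real.rpow_one]
  · push Not at h
    obtain ⟨B, hB, hodd⟩ := h
    rw [Finset.prod_eq_zero hB (moment_eq_zero_of_odd hX (by simpa using hodd)), mul_zero, abs_zero]

end Cumulant

theorem theorem3p4 :
    (∀ {Ω : Type*} [MeasurableSpace Ω] (μ : Measure Ω) [IsProbabilityMeasure μ] (X : Ω → ℝ),
      AEMeasurable X μ → IdentDistrib X (fun ω => -X ω) μ μ →
        (∀ n : ℕ, Odd n → Integrable (fun ω => |X ω| ^ n) μ → cumulant X n μ = 0) ∧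
        (∀ m : ℕ, 1 ≤ m → Integrable (fun ω => |X ω| ^ (2 * m)) μ →
          |cumulant X (2 * m) μ| ≤ (Csym (2 * m) : ℝ) * ∫ ω, |X ω| ^ (2 * m) ∂μ)) ∧
    (fun m : ℕ => (Csym (2 * m) : ℝ)) ~[atTop]
      (fun m : ℕ => 2 * ((2 * m - 1)! : ℝ) / rhoSym ^ (2 * m)) ∧
    |rhoSym - 1.317| < 0.0005 := by
  refine ⟨fun μ _ X hXm hX => ⟨fun n hn _ => cumulant_eq_zero_of_odd hX hn, fun m hm hint =>
    abs_cumulant_le_of_symmetric hXm hX (by omega) hint⟩, Csym_isEquivalent, ?_⟩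
  rw [abs_lt]
  constructor
  · linarith [lt_rhoSym]
  · linarith [rhoSym_lt]
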